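/- Let $X$ be a locally compact Hausdorff space. For a compact subset $K\subseteq X$, let $\operatorname{Homeo}_K(X)$ denote the group of all homeomorphisms $h\colon X\to X$ such that $h(x)=x$ for every $x\in X\setminus K$, equipped with the compact-open topology; it is a topological group. Let $\mathscr K(X)$ denote the set of compact subsets of $X$, ordered by inclusion, and for $B\subseteq X$ let $\mathscr K(B)$ denote the set of compact subsets of $B$. We say that the family $\{\operatorname{Homeo}_K(X)\}_{K\in\mathscr K(X)}$ satisfies ACP (the algebraic colimit property) if, on the union $\bigcup_{K\in\mathscr K(X)}\operatorname{Homeo}_K(X)$, the finest topology making all the inclusions of the groups $\operatorname{Homeo}_K(X)$ continuous coincides with the finest group topology making all these inclusions continuous. A subset of $X$ is regular closed if it equals the closure of its interior in $X$. Let $A\subseteq X$ be a regular closed, $\sigma$-compact, non-compact, metrizable subset. If $\{\operatorname{Homeo}_K(X)\}_{K\in\mathscr K(X)}$ satisfies ACP, then at least one of the following holds: (i) $\operatorname{Homeo}_M(X)$ is locally compact for every compact metrizable subset $M\subseteq X$; or (ii) there is a regular closed compact set $K_0\subseteq A$ such that (1) for every $K\in\mathscr K(A)$ with $K_0\subseteq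 K$, the subset $\operatorname{Homeo}_{K_0}(X)$ is open in $\operatorname{Homeo}_K(X)$; and (2) for every $C\in\mathscr K(\overline{A\setminus K_0})$, the group $\operatorname{Homeo}_C(X)$ is discrete. -/

import Mathlib

open Topology

/-- A subset of a topological space is *regular closed* if it is the closure of its interior. -/
def IsRegularClosed {X : Type*} [TopologicalSpace X] (A : Set X) : Prop :=
  closure (interior A) = A

/-- The compact-open topology on the set of self-homeomorphisms of `X`, that is, the topology
induced by the compact-open topology on the set `C(X, X)` of continuous self-maps. -/
instance Homeomorph.compactOpenTopology {X : Type*} [TopologicalSpace X] :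
    TopologicalSpace (X ≃ₜ X) :=
  TopologicalSpace.induced (fun h => (⟨h, h.continuous⟩ : C(X, X))) ContinuousMap.compactOpen

/-- The group of homeomorphisms of `X` that fix every point outside `K`. As a subtype of
`X ≃ₜ X` it carries the compact-open topology. -/
def homeoOn {X : Type*} [TopologicalSpace X] (K : Set X) : Subgroup (X ≃ₜ X) where
  carrier := {h | ∀ x, x ∉ K → h x = x}
  one_mem' := fun _ _ => rfl
  mul_mem' := by
    intro f g hf hg x hx
    change f (g x) = x
    rw [hg x hx, hf x hx]
  inv_mem' := by
    intro f hf x hx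
    change f.symm x = x
    rw [Homeomorph.symm_apply_eq, hf x hx]

section Colimit

variable {G : Type*} [Group G] {I : Type*} (S : I → Subgroup G)
  (τ : ∀ i, TopologicalSpace (S i))

/-- The colimit space topology of a directed family `S i` of groups (subgroups of an ambient
abstract group `G`, ordered by inclusion), each with a topology `τ i`: the finest topology on the
union of the family for which all inclusions are continuous. A set `U` is open if and only if
its preimage in every `S i` is open. For a nonempty directed family the union is `⨆ i, S i`. -/
@[reducible] def colimitSpaceTopology : TopologicalSpace (⨆ i, S i : Subgroup G) :=
  ⨆ i, TopologicalSpace.coinduced (Subgroup.inclusion (le_iSup S i)) (τ i)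

/-- The colimit group topology: the finest group topology on the union of the family for which
all inclusions are continuous. (In Mathlib's order on topologies, finer is smaller, and the
infimum of a set of group topologies is the topology generated by all of them.) -/
def colimitGroupTopology : GroupTopology (⨆ i, S i : Subgroup G) :=
  sInf {t | ∀ i, Continuous[τ i, t.toTopologicalSpace] (Subgroup.inclusion (le_iSup S i))}

/-- The algebraic colimit property: the colimit space topology and the colimit group topology
on the union coincide. -/
def SatisfiesACP : Prop :=
  colimitSpaceTopology S τ = (colimitGroupTopology S τ).toTopologicalSpace

end Colimit

/-- The family of the topological groups `homeoOn K`, where `K` ranges over the compact subsets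
of `X`, satisfies the algebraic colimit property. -/
def HomeoSatisfiesACP (X : Type*) [TopologicalSpace X] : Prop :=
  SatisfiesACP (fun K : TopologicalSpace.Compacts X => homeoOn (K : Set X))
    (fun _ => instTopologicalSpaceSubtype)

/-- The supremum of the groups `homeoOn K` is their union. -/
theorem mem_iSup_homeoOn {X : Type*} [TopologicalSpace X] [T2Space X] (h : X ≃ₜ X) :
    h ∈ (⨆ K : TopologicalSpace.Compacts X, homeoOn (K : Set X)) ↔
      ∃ K : TopologicalSpace.Compacts X, h ∈ homeoOn (K : Set X) := by
  refine Subgroup.mem_iSup_of_directed fun K L => ⟨K ⊔ L, ?_, ?_⟩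
  · intro f hf x hx
    exact hf x fun h' => hx (Or.inl h')
  · intro f hf x hx
    exact hf x fun h' => hx (Or.inr h')

open Filter Set

/-! ### Topology of the groups `homeoOn K`. -/

section HomeoTopology

variable {X : Type*} [TopologicalSpace X]

/-! Condition (2) follows from (1) (`discreteTopology_homeoOn_of_isOpen`), so if (ii) fails, A is
exhausted by compact sets K n with `homeoOn (K n)` never open in `homeoOn (K (n + 1))`. If (i) also
fails at M, take x n k in the n-th basic neighbourhood of 1 in `homeoOn M`, without cluster point in
k, and y n k outside `homeoOn (K n)`, tending to 1 in `homeoOn (K (n + 1))`. The set S of all x n k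
* (y n k)⁻¹ meets every `homeoOn L` in a closed set and misses 1, yet every colimit neighbourhood of
1 contains some x n k and y n k. Thus division is not continuous at 1 for the colimit space
topology, against ACP. -/

theorem Homeomorph.isInducing_toContinuousMap :
    IsInducing (fun h : X ≃ₜ X => (⟨h, h.continuous⟩ : C(X, X))) :=
  ⟨rfl⟩

instance Homeomorph.instT2SpaceCompactOpen [T2Space X] : T2Space (X ≃ₜ X) :=
  T2Space.of_injective_continuous (f := fun h : X ≃ₜ X => (⟨h, h.continuous⟩ : C(X, X)))
    (fun _ _ hfg => Homeomorph.ext fun x => DFunLike.congr_fun hfg x)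
    Homeomorph.isInducing_toContinuousMap.continuous

instance Homeomorph.instContinuousMulCompactOpen [LocallyCompactSpace X] :
    ContinuousMul (X ≃ₜ X) where
  continuous_mul := by
    rw [Homeomorph.isInducing_toContinuousMap.continuous_iff]
    have hc := Homeomorph.isInducing_toContinuousMap (X := X) |>.continuous
    exact (hc.comp continuous_fst).compCM (hc.comp continuous_snd)

theorem Homeomorph.continuous_apply_const (x : X) : Continuous fun h : X ≃ₜ X => h x :=
  (ContinuousEvalConst.continuous_eval_const (F := C(X, X)) x).comp
    Homeomorph.isInducing_toContinuousMap.continuous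

instance homeoOn.instContinuousMul [LocallyCompactSpace X] (K : Set X) :
    ContinuousMul (homeoOn K) :=
  Submonoid.continuousMul (homeoOn K).toSubmonoid

theorem homeoOn_mono {K L : Set X} (h : K ⊆ L) : homeoOn K ≤ homeoOn L :=
  fun _ hf x hx => hf x fun hK => hx (h hK)

theorem isClosed_homeoOn [T2Space X] (K : Set X) : IsClosed (homeoOn K : Set (X ≃ₜ X)) := by
  have : (homeoOn K : Set (X ≃ₜ X)) = ⋂ x ∈ Kᶜ, {h : X ≃ₜ X | h x = x} := by
    ext h
    simp only [mem_iInter, mem_compl_iff, mem_ofPred_eq]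
    rfl
  rw [this]
  exact isClosed_biInter fun x _ =>
    isClosed_eq (Homeomorph.continuous_apply_const x) continuous_const

theorem apply_mem_of_mem_homeoOn {K : Set X} {h : X ≃ₜ X} (hh : h ∈ homeoOn K) {x : X}
    (hx : x ∈ K) : h x ∈ K := by
  by_contra hn
  have : h x = x := h.injective (hh _ hn)
  exact hn (this.symm ▸ hx)

/-- The restriction of a homeomorphism supported in `M` to a self-map of `M`. -/
def homeoOnRestrict (M : Set X) (h : homeoOn M) : C(M, M) :=
  ⟨fun x => ⟨h.1 x, apply_mem_of_mem_homeoOn h.2 x.2⟩, by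
    exact (h.1.continuous.comp continuous_subtype_val).subtype_mk _⟩

/-- Off M every map is the identity, so only the behaviour on M matters. This transfers
metrizability from C(M, M). -/
theorem isInducing_homeoOnRestrict [T2Space X] {M : Set X} (hM : IsCompact M) :
    IsInducing (homeoOnRestrict M) := by
  have hcont : Continuous (homeoOnRestrict M) := by
    rw [(ContinuousMap.isInducing_postcomp (X := M)
      (⟨Subtype.val, continuous_subtype_val⟩ : C(M, X)) IsInducing.subtypeVal).continuous_iff]
    exact (ContinuousMap.continuous_restrict M).comp
      (Homeomorph.isInducing_toContinuousMap.continuous.comp continuous_subtype_val)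
  refine isInducing_iff_nhds.mpr fun h₀ => le_antisymm hcont.continuousAt.le_comap ?_
  rw [nhds_subtype_eq_comap, Homeomorph.isInducing_toContinuousMap.nhds_eq_comap, comap_comap,
    ← tendsto_iff_comap, ContinuousMap.tendsto_nhds_compactOpen]
  intro K hK U hU hKU
  have key : ∀ᶠ h in comap (homeoOnRestrict M) (𝓝 (homeoOnRestrict M h₀)),
      MapsTo (homeoOnRestrict M h) (Subtype.val ⁻¹' K) (Subtype.val ⁻¹' U) :=
    tendsto_comap.eventually (ContinuousMap.eventually_mapsTo
      (hM.isClosed.isClosedEmbedding_subtypeVal.isCompact_preimage hK)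
      (hU.preimage continuous_subtype_val) fun x hx => hKU hx)
  filter_upwards [key] with h hh x hx
  by_cases hxM : x ∈ M
  · exact hh (x := ⟨x, hxM⟩) hx
  · have h1 : h.1 x = x := h.2 x hxM
    have h2 : h₀.1 x = x := h₀.2 x hxM
    have h3 : h₀.1 x ∈ U := hKU hx
    change h.1 x ∈ U
    rwa [h1, ← h2]

theorem pseudoMetrizableSpace_homeoOn [T2Space X] {M : Set X} (hM : IsCompact M)
    [TopologicalSpace.MetrizableSpace M] :
    TopologicalSpace.PseudoMetrizableSpace (homeoOn M) := by
  have : CompactSpace M := isCompact_iff_compactSpace.mp hM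
  let := TopologicalSpace.metrizableSpaceMetric M
  exact (isInducing_homeoOnRestrict hM).pseudoMetrizableSpace

theorem eq_one_of_mem_homeoOn [T2Space X] {K : Set X} (hK : interior K = ∅) {h : X ≃ₜ X}
    (hh : h ∈ homeoOn K) : h = 1 := by
  have hd : Dense Kᶜ := interior_eq_empty_iff_dense_compl.mp hK
  have := Continuous.ext_on hd h.continuous continuous_id (fun x hx => hh x hx)
  exact Homeomorph.ext fun x => congrFun this x

end HomeoTopology

/-! ### Regular closed sets and discreteness. -/

section RegularClosed

variable {X : Type*} [TopologicalSpace X]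

theorem isRegularClosed_closure_of_isOpen {U : Set X} (hU : IsOpen U) :
    IsRegularClosed (closure U) :=
  (closure_mono interior_subset).trans closure_closure.subset |>.antisymm
    (closure_mono (hU.subset_interior_iff.mpr subset_closure))

theorem IsRegularClosed.isClosed {A : Set X} (hA : IsRegularClosed A) : IsClosed A :=
  hA ▸ isClosed_closure

/-- In a regular closed set, compact subsets have regular closed compact neighbourhoods. -/
theorem IsRegularClosed.exists_isCompact_superset [LocallyCompactSpace X] [T2Space X] {A : Set X}
    (hA : IsRegularClosed A) {K : Set X} (hK : IsCompact K) :
    ∃ U L : Set X, IsOpen U ∧ K ⊆ U ∧ U ∩ A ⊆ L ∧ IsRegularClosed L ∧ IsCompact L ∧ L ⊆ A := by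
  obtain ⟨C, hC, hKC⟩ := exists_compact_superset hK
  refine ⟨interior C, closure (interior C ∩ interior A), isOpen_interior, hKC, ?_,
    isRegularClosed_closure_of_isOpen (isOpen_interior.inter isOpen_interior), ?_, ?_⟩
  · have := isOpen_interior.inter_closure (s := interior C) (t := interior A)
    rwa [hA] at this
  · exact hC.of_isClosed_subset isClosed_closure
      (closure_minimal (inter_subset_left.trans interior_subset) hC.isClosed)
  · exact closure_minimal (inter_subset_right.trans interior_subset) hA.isClosed

/-- If `homeoOn K₀` is open in `homeoOn K` for all larger compact
`K ⊆ A`, then `homeoOn C` is discrete for compact `C ⊆ closure (A \ K₀)`. -/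
theorem discreteTopology_homeoOn_of_isOpen [LocallyCompactSpace X] [T2Space X] {A K₀ : Set X}
    (hA : IsClosed A) (hK₀c : IsCompact K₀) (hK₀A : K₀ ⊆ A)
    (hopen : ∀ K : Set X, IsCompact K → K ⊆ A → K₀ ⊆ K →
        IsOpen ((homeoOn K₀).subgroupOf (homeoOn K) : Set (homeoOn K)))
    {C : Set X} (hC : IsCompact C) (hCA : C ⊆ closure (A \ K₀)) :
    DiscreteTopology (homeoOn C) := by
  have hCA' : C ⊆ A := hCA.trans (closure_minimal sdiff_subset hA)
  have ho := hopen (C ∪ K₀) (hC.union hK₀c) (union_subset hCA' hK₀A) subset_union_right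
  -- The interior of K₀ is disjoint from the closure of A \ K₀. Hence `homeoOn C` and `homeoOn K₀`
  -- intersect trivially.
  have hi : interior (C ∩ K₀) = ∅ := by
    rw [interior_inter, eq_empty_iff_forall_notMem]
    rintro x ⟨hxC, hxK⟩
    obtain ⟨y, hy, hyA⟩ := mem_closure_iff.mp (hCA (interior_subset hxC)) _ isOpen_interior hxK
    exact hyA.2 (interior_subset hy)
  have hpre := ho.preimage
    (continuous_inclusion (homeoOn_mono (subset_union_left : C ⊆ C ∪ K₀)))
  refine discreteTopology_of_isOpen_singleton_one ?_
  refine (Set.ext fun h => ⟨fun hh => ?_, ?_⟩ : _ = ({1} : Set (homeoOn C))) ▸ hpre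
  · refine Subtype.ext (eq_one_of_mem_homeoOn hi fun x hx => ?_)
    by_cases hxC : x ∈ C
    · exact hh x fun hxK => hx ⟨hxC, hxK⟩
    · exact h.2 x hxC
  · rintro rfl
    exact one_mem (homeoOn K₀)

end RegularClosed

/-! ### Sequences without cluster points. -/

section NotLocallyCompact

/-- In a pseudometrizable topological monoid which is a group and is not locally compact, there are
sequences without cluster points in arbitrarily small neighbourhoods of the identity. -/
theorem exists_seq_forall_not_mapClusterPt {G : Type*} [Group G] [TopologicalSpace G] [T2Space G]
    [ContinuousMul G] [TopologicalSpace.PseudoMetrizableSpace G] (hG : ¬ LocallyCompactSpace G)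
    {V : Set G} (hV : V ∈ 𝓝 (1 : G)) :
    ∃ x : ℕ → G, (∀ k, x k ∈ V) ∧ ∀ g, ¬ MapClusterPt g atTop x := by
  obtain ⟨N, hN, hNc, hNV⟩ := exists_mem_nhds_isClosed_subset hV
  have hNK : ¬ IsCompact N := by
    intro hNK
    refine hG ?_
    have : WeaklyLocallyCompactSpace G := ⟨fun g => by
      refine ⟨(g * ·) '' N, hNK.image (continuous_const_mul g), ?_⟩
      have := (Homeomorph.mulLeft g).isOpenMap.image_mem_nhds hN
      simpa using this⟩
    infer_instance
  let := TopologicalSpace.pseudoMetrizableSpacePseudoMetric G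
  rw [isCompact_iff_isSeqCompact, IsSeqCompact] at hNK
  push Not at hNK
  obtain ⟨x, hxN, hx⟩ := hNK
  refine ⟨x, fun k => hNV (hxN k), fun g hg => ?_⟩
  obtain ⟨φ, hφ, hlim⟩ := hg.tendsto_subseq
  exact hx g (hNc.mem_of_tendsto hlim (Eventually.of_forall fun k => hxN _)) φ hφ hlim

/-- A subgroup that is not open contains no neighbourhood of the identity. -/
theorem exists_seq_tendsto_one_notMem {G : Type*} [Group G] [TopologicalSpace G]
    [ContinuousMul G] [FirstCountableTopology G] {H : Subgroup G} (hH : ¬ IsOpen (H : Set G)) :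
    ∃ y : ℕ → G, Tendsto y atTop (𝓝 1) ∧ ∀ k, y k ∉ H := by
  have h1 : (1 : G) ∈ closure (H : Set G)ᶜ := by
    rw [closure_compl, mem_compl_iff, mem_interior_iff_mem_nhds]
    exact fun h => hH (H.isOpen_of_mem_nhds h)
  obtain ⟨y, hy, hlim⟩ := mem_closure_iff_seq_limit.mp h1
  exact ⟨y, hlim, hy⟩

/-- If `x` has no cluster point and `y` tends to the identity, then `x * y⁻¹` has closed range. -/
theorem isClosed_range_mul_inv {G : Type*} [Group G] [TopologicalSpace G] [ContinuousMul G]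
    [T1Space G] {x y : ℕ → G} (hx : ∀ g, ¬ MapClusterPt g atTop x)
    (hy : Tendsto y atTop (𝓝 1)) : IsClosed (range fun k => x k * (y k)⁻¹) := by
  have hz : ∀ g, ¬ MapClusterPt g atTop fun k => x k * (y k)⁻¹ := by
    intro g hg
    obtain ⟨U, hU, hlim⟩ := mapClusterPt_iff_ultrafilter.mp hg
    refine hx g (mapClusterPt_iff_ultrafilter.mpr ⟨U, hU, ?_⟩)
    -- Since x = (x * y⁻¹) * y, continuity of multiplication suffices.
    simpa using hlim.mul (hy.mono_left hU)
  rw [← iUnion_singleton_eq_range]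
  refine LocallyFinite.isClosed_iUnion (fun g => ?_) fun _ => isClosed_singleton
  have := hz g
  rw [mapClusterPt_iff_frequently] at this
  push Not at this
  obtain ⟨s, hs, hfin⟩ := this
  refine ⟨s, hs, ?_⟩
  rw [← Nat.cofinite_eq_atTop, eventually_cofinite] at hfin
  refine hfin.subset fun k hk => ?_
  obtain ⟨_, rfl, h⟩ := hk
  exact not_not.mpr h

end NotLocallyCompact

/-! ### Contradiction with the algebraic colimit property. -/

section Colimit

variable {X : Type*} [TopologicalSpace X]

/-- Under the algebraic colimit property, division is continuous at the identity for the colimit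
space topology. -/
theorem HomeoSatisfiesACP.exists_forall_mul_inv_notMem (hACP : HomeoSatisfiesACP X)
    {S : Set (X ≃ₜ X)} (h1 : 1 ∉ S)
    (hS : ∀ K : Set X, IsCompact K → IsClosed (Subtype.val ⁻¹' S : Set (homeoOn K))) :
    ∃ V : Set (X ≃ₜ X), (∀ K : Set X, IsCompact K →
      (Subtype.val ⁻¹' V : Set (homeoOn K)) ∈ 𝓝 1) ∧ ∀ g ∈ V, ∀ h ∈ V, g * h⁻¹ ∉ S := by
  set F : TopologicalSpace.Compacts X → Subgroup (X ≃ₜ X) := fun K => homeoOn (K : Set X) with hF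
  let t := colimitGroupTopology F (fun _ => instTopologicalSpaceSubtype)
  have hst : colimitSpaceTopology F (fun _ => instTopologicalSpaceSubtype) = t.toTopologicalSpace :=
    hACP
  let T : TopologicalSpace (⨆ i, F i : Subgroup (X ≃ₜ X)) := t.toTopologicalSpace
  have : IsTopologicalGroup (⨆ i, F i : Subgroup (X ≃ₜ X)) := t.toIsTopologicalGroup
  have hinc : ∀ K, Continuous (Subgroup.inclusion (le_iSup F K)) := by
    intro K
    rw [continuous_iff_coinduced_le]
    change _ ≤ t.toTopologicalSpace
    rw [← hst]
    exact le_iSup (fun K => TopologicalSpace.coinduced (Subgroup.inclusion (le_iSup F K))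
      instTopologicalSpaceSubtype) K
  have hopen : IsOpen (Subtype.val ⁻¹' Sᶜ : Set (⨆ i, F i : Subgroup (X ≃ₜ X))) := by
    change IsOpen[t.toTopologicalSpace] _
    rw [← hst, isOpen_iSup_iff]
    intro K
    rw [isOpen_coinduced]
    exact (hS K K.isCompact).isOpen_compl
  have hd : Tendsto (fun p : (⨆ i, F i : Subgroup (X ≃ₜ X)) × (⨆ i, F i : Subgroup (X ≃ₜ X)) =>
      p.1 * p.2⁻¹) (𝓝 (1, 1)) (𝓝 1) := by
    have : Continuous (fun p : (⨆ i, F i : Subgroup (X ≃ₜ X)) × (⨆ i, F i : Subgroup (X ≃ₜ X)) =>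
      p.1 * p.2⁻¹) := by fun_prop
    simpa using this.tendsto (1, 1)
  have hmem := hd (hopen.mem_nhds h1)
  rw [nhds_prod_eq, mem_map, mem_prod_same_iff] at hmem
  obtain ⟨W, hW, hWS⟩ := hmem
  refine ⟨Subtype.val '' W, fun K hK => ?_, ?_⟩
  · filter_upwards [(hinc ⟨K, hK⟩).continuousAt (x := 1) hW] with g hg
    exact ⟨_, hg, rfl⟩
  · rintro _ ⟨g, hg, rfl⟩ _ ⟨h, hh, rfl⟩
    exact hWS (mk_mem_prod hg hh)

variable [LocallyCompactSpace X] [T2Space X]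

/-- Under the algebraic colimit property, a non-locally compact `homeoOn M` cannot coexist with a
sequence of strictly non-open inclusions `homeoOn (K n) ≤ homeoOn (K (n + 1))`. -/
theorem HomeoSatisfiesACP.locallyCompactSpace_of_not_isOpen (hACP : HomeoSatisfiesACP X)
    {A : Set X} (hA : IsClosed A) {M : Set X} (hM : IsCompact M)
    [TopologicalSpace.MetrizableSpace M] {K : ℕ → Set X}
    (hmono : Monotone K) (hK : ∀ n, IsCompact (K n)) (hKA : ∀ n, K n ⊆ A)
    (hKm : ∀ n, TopologicalSpace.MetrizableSpace (K n)) (hMK : M ∩ A ⊆ K 0)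
    (hcof : ∀ L, IsCompact L → L ⊆ A → ∃ n, L ⊆ K n)
    (hno : ∀ n, ¬ IsOpen ((homeoOn (K n)).subgroupOf (homeoOn (K (n + 1))) :
      Set (homeoOn (K (n + 1))))) :
    LocallyCompactSpace (homeoOn M) := by
  by_contra hlc
  have := pseudoMetrizableSpace_homeoOn hM
  have (n : ℕ) := pseudoMetrizableSpace_homeoOn (hK n)
  obtain ⟨B, hB⟩ := (𝓝 (1 : homeoOn M)).exists_antitone_basis
  choose x hxB hx using fun n => exists_seq_forall_not_mapClusterPt hlc (hB.mem n)
  choose y hy hyK using fun n => exists_seq_tendsto_one_notMem (hno n)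
  let z : ℕ → ℕ → (X ≃ₜ X) := fun n k => (x n k : X ≃ₜ X) * (y n k : X ≃ₜ X)⁻¹
  have hx' : ∀ n g, ¬ MapClusterPt g atTop fun k => (x n k : X ≃ₜ X) := by
    intro n g hg
    have hgM : g ∈ homeoOn M := by
      refine (isClosed_homeoOn M).mem_of_mapClusterPt hg (Eventually.of_forall fun k => (x n k).2)
    obtain ⟨U, hU, hlim⟩ := mapClusterPt_iff_ultrafilter.mp hg
    exact hx n ⟨g, hgM⟩ (mapClusterPt_iff_ultrafilter.mpr ⟨U, hU, tendsto_subtype_rng.mpr hlim⟩)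
  have hZ : ∀ n, IsClosed (range (z n)) := fun n =>
    isClosed_range_mul_inv (hx' n) 
      ((continuous_subtype_val.tendsto _).comp (hy n))
  -- Otherwise y n k would be supported in L ∩ A, hence in K n.
  have hz : ∀ n k L, K n ⊆ L → M ⊆ L → L ∩ A ⊆ K n → z n k ∉ homeoOn L := by
    intro n k L hKL hML hLK hzL
    refine hyK n k fun p hp => ?_
    have hyL : (y n k : X ≃ₜ X) ∈ homeoOn L := by
      have : (y n k : X ≃ₜ X) = (z n k)⁻¹ * x n k := by simp [z]
      rw [this]
      exact mul_mem (inv_mem hzL) (homeoOn_mono hML (x n k).2)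
    by_cases hpL : p ∈ L
    · exact (y n k).2 p fun hpK => hp (hLK ⟨hpL, hKA _ hpK⟩)
    · exact hyL p hpL
  have hMKn : ∀ n L, L ∩ A ⊆ K n → (K n ∪ M ∪ L) ∩ A ⊆ K n := by
    rintro n L hL p ⟨(hp | hp) | hp, hpA⟩
    · exact hp
    · exact hmono n.zero_le (hMK ⟨hp, hpA⟩)
    · exact hL ⟨hp, hpA⟩
  obtain ⟨V, hV, hVS⟩ := hACP.exists_forall_mul_inv_notMem (S := ⋃ n, range (z n)) (by
    rintro ⟨_, ⟨n, rfl⟩, k, hk⟩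
    refine hz n k (K n ∪ M ∪ ∅) ?_ ?_ (hMKn n ∅ (by simp)) (hk ▸ one_mem _)
    · exact subset_union_left.trans subset_union_left
    · exact subset_union_right.trans subset_union_left) (by
    intro L hL
    obtain ⟨m, hm⟩ := hcof (L ∩ A) (hL.inter_right hA) inter_subset_right
    -- Only the finitely many n with n < m contribute to S inside `homeoOn L`.
    have : (Subtype.val ⁻¹' (⋃ n, range (z n)) : Set (homeoOn L)) =
        Subtype.val ⁻¹' (⋃ n ∈ Iio m, range (z n)) := by
      ext g
      simp only [mem_preimage, mem_iUnion, mem_Iio, exists_prop]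
      refine ⟨fun ⟨n, hn⟩ => ⟨n, ?_, hn⟩, fun ⟨n, _, hn⟩ => ⟨n, hn⟩⟩
      by_contra hmn
      obtain ⟨k, hk⟩ := hn
      refine hz n k (K n ∪ M ∪ L) (subset_union_left.trans subset_union_left)
        (subset_union_right.trans subset_union_left)
        (hMKn n L (hm.trans (hmono (not_lt.mp hmn)))) ?_
      exact hk ▸ homeoOn_mono subset_union_right g.2
    rw [this]
    exact ((finite_Iio m).isClosed_biUnion fun n _ => hZ n).preimage continuous_subtype_val)
  obtain ⟨n, -, hn⟩ := hB.toHasBasis.mem_iff.mp (hV M hM)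
  obtain ⟨k, hk⟩ := ((hy n).eventually (hV _ (hK (n + 1)))).exists
  exact hVS _ (hn (hxB n k)) _ hk (mem_iUnion.mpr ⟨n, k, rfl⟩)

end Colimit

theorem mainTheorem10 {X : Type*} [TopologicalSpace X] [LocallyCompactSpace X] [T2Space X]
    (A : Set X) (hA_reg : IsRegularClosed A) (hA_sigma : IsSigmaCompact A)
    (hA_noncompact : ¬ IsCompact A) (hA_metrizable : TopologicalSpace.MetrizableSpace A)
    (hACP : HomeoSatisfiesACP X) :
    (∀ M : Set X, IsCompact M → TopologicalSpace.MetrizableSpace M →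
      LocallyCompactSpace (homeoOn M)) ∨
    (∃ K₀ : Set X, IsRegularClosed K₀ ∧ IsCompact K₀ ∧ K₀ ⊆ A ∧
      (∀ K : Set X, IsCompact K → K ⊆ A → K₀ ⊆ K →
        IsOpen ((homeoOn K₀).subgroupOf (homeoOn K) : Set (homeoOn K))) ∧
      (∀ C : Set X, IsCompact C → C ⊆ closure (A \ K₀) →
        DiscreteTopology (homeoOn C))) := by
  by_contra hcon
  push Not at hcon
  obtain ⟨⟨M, hM, hMm, hlc⟩, hK₀⟩ := hcon
  have hAc := hA_reg.isClosed
  have hbad : ∀ K₀ : Set X, IsRegularClosed K₀ → IsCompact K₀ → K₀ ⊆ A →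
      ∃ K : Set X, IsCompact K ∧ K ⊆ A ∧ K₀ ⊆ K ∧
        ¬ IsOpen ((homeoOn K₀).subgroupOf (homeoOn K) : Set (homeoOn K)) := by
    intro K₀ hr hc hs
    by_contra! hopen
    obtain ⟨C, hC, hCA, hnd⟩ := hK₀ K₀ hr hc hs hopen
    exact hnd (discreteTopology_homeoOn_of_isOpen hAc hc hs hopen hC hCA)
  obtain ⟨C, hC, hCA⟩ := hA_sigma
  let P : Set X → Prop := fun K => IsRegularClosed K ∧ IsCompact K ∧ K ⊆ A
  have hstep : ∀ (n : ℕ) (K : {K // P K}), ∃ L : {K // P K}, K.1 ⊆ L.1 ∧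
      (∃ U, IsOpen U ∧ C n ⊆ U ∧ U ∩ A ⊆ L.1) ∧
      ¬ IsOpen ((homeoOn K.1).subgroupOf (homeoOn L.1) : Set (homeoOn L.1)) := by
    rintro n ⟨K, hr, hc, hs⟩
    obtain ⟨K', hK'c, hK'A, hKK', hno⟩ := hbad K hr hc hs
    -- Adding C n makes the sequence exhaust A; non-openness survives enlarging K'.
    obtain ⟨U, L, hU, hKU, hUL, hLr, hLc, hLA⟩ :=
      hA_reg.exists_isCompact_superset (hK'c.union (hC n))
    have hK'L : K' ⊆ L := fun p hp => hUL ⟨hKU (Or.inl hp), hK'A hp⟩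
    refine ⟨⟨L, hLr, hLc, hLA⟩, hKK'.trans hK'L,
      ⟨U, hU, subset_union_right.trans hKU, hUL⟩, fun ho => hno ?_⟩
    exact ho.preimage (continuous_inclusion (homeoOn_mono hK'L))
  choose next hnext hU hno using hstep
  choose U hUo hCU hUL using hU
  obtain ⟨U₀, L₀, -, hMU, hUL₀, hL₀⟩ :=
    hA_reg.exists_isCompact_superset (hM.inter_right hAc)
  let K : ℕ → {K // P K} := fun n => Nat.rec ⟨L₀, hL₀⟩ next n
  have hmono : Monotone fun n => (K n).1 := monotone_nat_of_le_succ fun n => hnext n (K n)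
  refine hlc (hACP.locallyCompactSpace_of_not_isOpen hAc hM (K := fun n => (K n).1) hmono
    (fun n => (K n).2.2.1) (fun n => (K n).2.2.2) (fun n => ?_) ?_ (fun L hL hLA => ?_)
    fun n => hno n (K n))
  · exact (IsEmbedding.inclusion (K n).2.2.2).metrizableSpace
  · exact fun p hp => hUL₀ ⟨hMU hp, hp.2⟩
  -- The open sets U i, unlike the C i, allow compactness to place L in a single stage.
  · obtain ⟨n, hn⟩ := hL.elim_directed_cover (fun n => ⋃ i ∈ Iio n, U i (K i))
      (fun n => isOpen_biUnion fun i _ => hUo i (K i))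
      (fun p hp => by
        obtain ⟨i, hi⟩ := mem_iUnion.mp (hCA.symm ▸ hLA hp)
        exact mem_iUnion.mpr ⟨i + 1, mem_biUnion (Nat.lt_succ_self i) (hCU i (K i) hi)⟩)
      (Monotone.directed_le fun a b hab => biUnion_subset_biUnion_left (Iio_subset_Iio hab))
    refine ⟨n, fun p hp => ?_⟩
    obtain ⟨i, hi, hpi⟩ := mem_iUnion₂.mp (hn hp)
    exact hmono (Nat.succ_le_of_lt hi) (hUL i (K i) ⟨hpi, hLA hp⟩)
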